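/- Let $G$ be a finite group acting (by homeomorphisms) on a compactly generated Hausdorff path connected space $X$ with basepoint $x_0$. Write $I=[0,1]$, $T^k=(\mathbb R/\mathbb Z)^k$ and $C_n=I\times T^{n-1}$ for $n\ge 1$. A map $f:C_n\to X$ has order $g\in G$ if $f(0,t)=x_0$ and $f(1,t)=gx_0$ for all $t\in T^{n-1}$. The Rhodes group $\sigma_n(X,x_0,G)$ is the set of pairs $[f;g]$ where $g\in G$ and $f$ is a map of order $g$, taken up to homotopy through maps of order $g$, with the product $[f';g']*[f;g]=[f'+g'f;\,g'g]$, where $+$ is concatenation in the $I$-coordinate. For a space $Y$ with basepoint $y_0$, Fox's torus homotopy group is $\tau_n(Y,y_0)=\pi_1(Y^{T^{n-1}},\text{constant map } y_0)$. Let $\Omega X$ be the space of loops at $x_0$ and $\overline{x_0}$ the constant loop. **Theorem 1.3.** For every $n\ge 2$ the sequence $$0\to \tau_{n-1}(\Omega X,\overline{x_0})\xrightarrow{\ \iota\ }\sigma_n(X,x_0,G)\xrightarrow{\ \rho\ }\sigma_{n-1}(X,x_0,G)\to 1$$ is a split short exact sequence of groups. Here * $\iota$ is given by adjunction: the class of $h:I\times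 T^{n-2}\to\Omega X$ goes to $[f;1]$, where $f(s,t_2,\dots,t_{n-1},[u])=h(s,t_2,\dots,t_{n-1})(u)$ for $u\in I$; * $\rho[f;g]=[f\circ i;g]$ with $i:C_{n-1}\to C_n$, $i(t_1,\dots,t_{n-1})=(t_1,\dots,t_{n-1},0)$; * the splitting is the homomorphism $s:\sigma_{n-1}(X,x_0,G)\to\sigma_n(X,x_0,G)$, $s[f;g]=[f\circ q;g]$, induced by the projection $q:C_n\to C_{n-1}$, $q(t_1,\dots,t_n)=(t_1,\dots,t_{n-1})$, and $\rho\circ s=\mathrm{id}$. This sequence generalizes Fox's sequence in the following sense. The sequence $$0\to \tau_{n-1}(\Omega X,\overline{x_0})\to\tau_n(X,x_0)\to\tau_{n-1}(X,x_0)\to 1,$$ with the maps and the section defined in the same way by adjunction, $i$ and $q$, is split short exact. For every $k\ge1$ the homomorphism $j_k:\tau_k(X,x_0)\to\sigma_k(X,x_0,G)$, $[f]\mapsto[f;1]$, is injective and its image is the kernel of $\sigma_k(X,x_0,G)\to G$, $[f;g]\mapsto g$ (so $j_k$ is an isomorphism when $G$ is trivial). The maps $j_n$, $j_{n-1}$ and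 the identity of $\tau_{n-1}(\Omega X,\overline{x_0})$ form a morphism from Fox's sequence to the sequence of Rhodes groups, and this morphism is compatible with the sections. -/

import Mathlib

open scoped unitInterval

noncomputable section

namespace RhodesTheory

/-! ### Tori and cylinders -/

/-- The `m`-dimensional torus `(ℝ/ℤ)^m`. -/
abbrev Torus (m : ℕ) : Type := Fin m → UnitAddCircle

/-- The inclusion `T^m → T^(m+1)`, `(t₁, …, t_m) ↦ (t₁, …, t_m, 0)`. -/
def torusIncl (m : ℕ) : C(Torus m, Torus (m + 1)) where
  toFun t := Fin.snoc (α := fun _ => UnitAddCircle) t 0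
  continuous_toFun := by
    refine continuous_pi fun i => ?_
    induction i using Fin.lastCases with
    | last => simpa using continuous_const
    | cast j => simpa using continuous_apply j

/-- The projection `T^(m+1) → T^m`, `(t₁, …, t_(m+1)) ↦ (t₁, …, t_m)`. -/
def torusProj (m : ℕ) : C(Torus (m + 1), Torus m) where
  toFun t i := t i.castSucc
  continuous_toFun := by fun_prop

theorem torusProj_comp_torusIncl (m : ℕ) :
    (torusProj m).comp (torusIncl m) = ContinuousMap.id _ := by
  ext t i
  simp [torusProj, torusIncl]

/-! ### Maps `I × T → X` as paths in the function space -/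

section Paths

variable {X T : Type*} [TopologicalSpace X] [TopologicalSpace T]

/-- The two ends `{0, 1} × T` of the cylinder `I × T`. -/
def cylEnds (T : Type*) : Set (I × T) := {p | p.1 = 0 ∨ p.1 = 1}

/-- The path in `X^T` adjoint to a map `I × T → X`. -/
def pathOf (f : C(I × T, X)) {x y : X} (h0 : ∀ t, f (0, t) = x)
    (h1 : ∀ t, f (1, t) = y) :
    Path (ContinuousMap.const T x) (ContinuousMap.const T y) where
  toContinuousMap := f.curry
  source' := ContinuousMap.ext h0
  target' := ContinuousMap.ext h1

theorem homotopic_pathOf_iff [LocallyCompactSpace T] {f f' : C(I × T, X)} {x y : X}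
    (h0 : ∀ t, f (0, t) = x) (h1 : ∀ t, f (1, t) = y)
    (h0' : ∀ t, f' (0, t) = x) (h1' : ∀ t, f' (1, t) = y) :
    (pathOf f h0 h1).Homotopic (pathOf f' h0' h1') ↔ f.HomotopicRel f' (cylEnds T) := by
  constructor
  · rintro ⟨H⟩
    refine ⟨⟨⟨⟨fun p => H (p.1, p.2.1) p.2.2, by fun_prop⟩, ?_, ?_⟩, ?_⟩⟩
    · rintro ⟨s, t⟩
      exact DFunLike.congr_fun (H.apply_zero s) t
    · rintro ⟨s, t⟩
      exact DFunLike.congr_fun (H.apply_one s) t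
    · rintro u ⟨s, t⟩ (rfl | rfl : s = 0 ∨ s = 1)
      · change H (u, 0) t = f (0, t)
        rw [H.source, h0, ContinuousMap.const_apply]
      · change H (u, 1) t = f (1, t)
        rw [H.target, h1, ContinuousMap.const_apply]
  · rintro ⟨H⟩
    refine ⟨⟨⟨ContinuousMap.curry ⟨fun p : (I × I) × T => H (p.1.1, (p.1.2, p.2)), by fun_prop⟩,
      ?_, ?_⟩, ?_⟩⟩
    · intro s
      ext t
      simp [pathOf]
    · intro s
      ext t
      simp [pathOf]
    · rintro u s (rfl | rfl)
      · ext t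
        exact H.eq_fst u (x := (0, t)) (Or.inl rfl)
      · ext t
        exact H.eq_fst u (x := (1, t)) (Or.inr rfl)

end Paths

/-! ### Maps of order `g` and the Rhodes groups -/

variable {G X : Type*} [Group G] [TopologicalSpace X] [MulAction G X]

/-- A map `f : I × T^m → X` of order `g`: `f(0, t) = x₀` and `f(1, t) = g x₀` for all `t`. -/
structure OrderMap (x₀ : X) (m : ℕ) (g : G) where
  toMap : C(I × Torus m, X)
  map_zero : ∀ t, toMap (0, t) = x₀
  map_one : ∀ t, toMap (1, t) = g • x₀

/-- Homotopy through maps of order `g`, that is, homotopy relative to `{0, 1} × T^m`. -/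
instance OrderMap.setoid (x₀ : X) (m : ℕ) (g : G) : Setoid (OrderMap x₀ m g) where
  r f f' := f.toMap.HomotopicRel f'.toMap (cylEnds (Torus m))
  iseqv := ⟨fun f => .refl f.toMap, fun h => h.symm, fun h h' => h.trans h'⟩

variable (G) in
/-- The underlying set of the Rhodes group `σ_(m+1)(X, x₀, G)`: the pairs `[f; g]` of an element
`g` of `G` and a homotopy class of maps `f : C_(m+1) = I × T^m → X` of order `g`.
(The index `m` is the dimension of the torus factor.) -/
def RhodesGroup (x₀ : X) (m : ℕ) : Type _ :=
  Σ g : G, Quotient (OrderMap.setoid x₀ m g)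

/-- The element `[f; g]` of the Rhodes group. -/
def RhodesGroup.mk {x₀ : X} {m : ℕ} {g : G} (f : OrderMap x₀ m g) : RhodesGroup G x₀ m :=
  ⟨g, Quotient.mk _ f⟩

theorem RhodesGroup.mk_eq_mk {x₀ : X} {m : ℕ} {g g' : G} {f : OrderMap x₀ m g}
    {f' : OrderMap x₀ m g'} (hg : g = g')
    (h : f.toMap.HomotopicRel f'.toMap (cylEnds (Torus m))) :
    RhodesGroup.mk f = RhodesGroup.mk f' := by
  subst hg
  exact congrArg (Sigma.mk g) (Quotient.sound h)

theorem RhodesGroup.ind {x₀ : X} {m : ℕ} {P : RhodesGroup G x₀ m → Prop}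
    (h : ∀ (g : G) (f : OrderMap x₀ m g), P (RhodesGroup.mk f)) (a : RhodesGroup G x₀ m) :
    P a := by
  obtain ⟨g, q⟩ := a
  induction q using Quotient.inductionOn with
  | h f => exact h g f

/-- The constant map, of order `1`. -/
def OrderMap.const (x₀ : X) (m : ℕ) : OrderMap x₀ m (1 : G) where
  toMap := ContinuousMap.const _ x₀
  map_zero _ := rfl
  map_one _ := (one_smul G x₀).symm

variable [ContinuousConstSMul G X]

/-- The translate `g f` of a map `f` into `X` by `g`. -/
def translate {Y : Type*} [TopologicalSpace Y] (g : G) (f : C(Y, X)) : C(Y, X) :=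
  ⟨fun y => g • f y, by fun_prop⟩

/-- The concatenation `f' + g' f : I × T^m → X`: it is `f'(2s, t)` for `s ≤ 1/2` and
`g' f(2s - 1, t)` for `s ≥ 1/2`. -/
def OrderMap.concat {x₀ : X} {m : ℕ} {g' g : G} (f' : OrderMap x₀ m g') (f : OrderMap x₀ m g) :
    OrderMap x₀ m (g' * g) where
  toMap :=
    { toFun := fun p => if (p.1 : ℝ) ≤ 1 / 2
        then f'.toMap (Set.projIcc 0 1 zero_le_one (2 * (p.1 : ℝ)), p.2)
        else g' • f.toMap (Set.projIcc 0 1 zero_le_one (2 * (p.1 : ℝ) - 1), p.2)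
      continuous_toFun := by
        refine Continuous.if_le ?_ ?_ (by fun_prop) (by fun_prop) ?_
        · exact f'.toMap.continuous.comp
            ((continuous_projIcc.comp (by fun_prop)).prodMk continuous_snd)
        · exact (f.toMap.continuous.comp
            ((continuous_projIcc.comp (by fun_prop)).prodMk continuous_snd)).const_smul g'
        · rintro ⟨s, t⟩ hs
          simp only at hs
          rw [hs]
          norm_num [f'.map_one, f.map_zero] }
  map_zero t := by
    have := f'.map_zero t
    simp [this]
  map_one t := by
    have := f.map_one t
    norm_num [this, mul_smul]

/-- The map `(s, t) ↦ g⁻¹ f(1 - s, t)`, of order `g⁻¹`. -/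
def OrderMap.inverse {x₀ : X} {m : ℕ} {g : G} (f : OrderMap x₀ m g) : OrderMap x₀ m g⁻¹ where
  toMap := ⟨fun p => g⁻¹ • f.toMap (σ p.1, p.2), by fun_prop⟩
  map_zero t := by simp [f.map_one]
  map_one t := by simp [f.map_zero]

theorem pathOf_concat {x₀ : X} {m : ℕ} {g' g : G} (f' : OrderMap x₀ m g') (f : OrderMap x₀ m g)
    {a b c : X} (h0 : ∀ t, (f'.concat f).toMap (0, t) = a)
    (h1 : ∀ t, (f'.concat f).toMap (1, t) = c) (h0' : ∀ t, f'.toMap (0, t) = a)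
    (h1' : ∀ t, f'.toMap (1, t) = b) (k0 : ∀ t, translate g' f.toMap (0, t) = b)
    (k1 : ∀ t, translate g' f.toMap (1, t) = c) :
    pathOf (f'.concat f).toMap h0 h1
      = (pathOf f'.toMap h0' h1').trans (pathOf (translate g' f.toMap) k0 k1) := by
  ext s t
  change (if (s : ℝ) ≤ 1 / 2 then _ else _) = _
  simp only [Path.trans, Path.coe_mk', ContinuousMap.coe_mk, Function.comp_apply]
  split_ifs <;> rfl

theorem pathOf_translate_concat {x₀ : X} {m : ℕ} {g' g : G} (h : G) (f' : OrderMap x₀ m g')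
    (f : OrderMap x₀ m g) {a b c : X}
    (h0 : ∀ t, translate h (f'.concat f).toMap (0, t) = a)
    (h1 : ∀ t, translate h (f'.concat f).toMap (1, t) = c)
    (h0' : ∀ t, translate h f'.toMap (0, t) = a)
    (h1' : ∀ t, translate h f'.toMap (1, t) = b)
    (k0 : ∀ t, translate (h * g') f.toMap (0, t) = b)
    (k1 : ∀ t, translate (h * g') f.toMap (1, t) = c) :
    pathOf (translate h (f'.concat f).toMap) h0 h1
      = (pathOf (translate h f'.toMap) h0' h1').trans
          (pathOf (translate (h * g') f.toMap) k0 k1) := by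
  ext s t
  change h • (if (s : ℝ) ≤ 1 / 2 then (_ : X) else _) = _
  simp only [Path.trans, Path.coe_mk', ContinuousMap.coe_mk, Function.comp_apply]
  split_ifs
  · rfl
  · exact (mul_smul _ _ _).symm

theorem OrderMap.concat_congr {x₀ : X} {m : ℕ} {g' g : G} {f' k' : OrderMap x₀ m g'}
    {f k : OrderMap x₀ m g} (h' : f'.toMap.HomotopicRel k'.toMap (cylEnds (Torus m)))
    (h : f.toMap.HomotopicRel k.toMap (cylEnds (Torus m))) :
    (f'.concat f).toMap.HomotopicRel (k'.concat k).toMap (cylEnds (Torus m)) := by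
  have e0 (u : OrderMap x₀ m g) : ∀ t, translate g' u.toMap (0, t) = g' • x₀ :=
    fun t => congrArg (g' • ·) (u.map_zero t)
  have e1 (u : OrderMap x₀ m g) : ∀ t, translate g' u.toMap (1, t) = (g' * g) • x₀ :=
    fun t => (congrArg (g' • ·) (u.map_one t)).trans (mul_smul _ _ _).symm
  have hg : (translate g' f.toMap).HomotopicRel (translate g' k.toMap) (cylEnds (Torus m)) :=
    h.comp_continuousMap ⟨fun x => g' • x, continuous_const_smul g'⟩
  rw [← homotopic_pathOf_iff (x := x₀) (y := ((g' * g) • x₀))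
      (f'.concat f).map_zero (f'.concat f).map_one (k'.concat k).map_zero (k'.concat k).map_one,
    pathOf_concat (b := (g' • x₀)) _ _ _ _ f'.map_zero f'.map_one (e0 f) (e1 f),
    pathOf_concat (b := (g' • x₀)) _ _ _ _ k'.map_zero k'.map_one (e0 k) (e1 k)]
  exact ((homotopic_pathOf_iff _ _ _ _).2 h').hcomp ((homotopic_pathOf_iff _ _ _ _).2 hg)

theorem OrderMap.concat_assoc {x₀ : X} {m : ℕ} {g₁ g₂ g₃ : G} (f₁ : OrderMap x₀ m g₁)
    (f₂ : OrderMap x₀ m g₂) (f₃ : OrderMap x₀ m g₃) :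
    ((f₁.concat f₂).concat f₃).toMap.HomotopicRel (f₁.concat (f₂.concat f₃)).toMap
      (cylEnds (Torus m)) := by
  have e0 (h : G) {g : G} (u : OrderMap x₀ m g) : ∀ t, translate h u.toMap (0, t) = h • x₀ :=
    fun t => congrArg (h • ·) (u.map_zero t)
  have e1 (h : G) {g : G} (u : OrderMap x₀ m g) : ∀ t, translate h u.toMap (1, t) = (h * g) • x₀ :=
    fun t => (congrArg (h • ·) (u.map_one t)).trans (mul_smul _ _ _).symm
  have E : ∀ t, (f₁.concat (f₂.concat f₃)).toMap (1, t) = (g₁ * g₂ * g₃) • x₀ := fun t => by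
    rw [(f₁.concat (f₂.concat f₃)).map_one, mul_assoc]
  have E' : ∀ t, translate g₁ (f₂.concat f₃).toMap (1, t) = (g₁ * g₂ * g₃) • x₀ := fun t => by
    rw [e1 g₁, mul_assoc]
  rw [← homotopic_pathOf_iff (x := x₀) (y := ((g₁ * g₂ * g₃) • x₀))
      (OrderMap.map_zero _) (OrderMap.map_one _) (OrderMap.map_zero _) E,
    pathOf_concat (b := ((g₁ * g₂) • x₀)) _ _ _ _ (OrderMap.map_zero _)
      (OrderMap.map_one _) (e0 _ f₃) (e1 _ f₃),
    pathOf_concat (b := (g₁ • x₀)) _ _ _ _ (OrderMap.map_zero _)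
      (OrderMap.map_one _) (e0 _ f₂) (e1 _ f₂),
    pathOf_concat (b := (g₁ • x₀)) _ _ _ _ (OrderMap.map_zero _)
      (OrderMap.map_one _) (e0 _ _) E',
    pathOf_translate_concat (b := ((g₁ * g₂) • x₀)) _ _ _ _ _ (e0 _ f₂) (e1 _ f₂)
      (e0 _ f₃) (e1 _ f₃)]
  exact ⟨Path.Homotopy.transAssoc _ _ _⟩

theorem OrderMap.const_concat {x₀ : X} {m : ℕ} {g : G} (f : OrderMap x₀ m g) :
    ((OrderMap.const x₀ m).concat f).toMap.HomotopicRel f.toMap (cylEnds (Torus m)) := by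
  have hf : translate (1 : G) f.toMap = f.toMap := by
    ext p
    exact one_smul _ _
  have E : ∀ t, ((OrderMap.const (G := G) x₀ m).concat f).toMap (1, t) = g • x₀ := fun t => by
    rw [OrderMap.map_one, one_mul]
  rw [← homotopic_pathOf_iff (x := x₀) (y := (g • x₀)) (OrderMap.map_zero _)
      E f.map_zero f.map_one,
    pathOf_concat (b := x₀) _ _ _ _ (fun _ => rfl) (fun _ => rfl)
      (by rw [hf]; exact f.map_zero) (by rw [hf]; exact f.map_one)]
  simp only [hf]
  exact ⟨Path.Homotopy.reflTrans _⟩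

theorem OrderMap.inverse_concat {x₀ : X} {m : ℕ} {g : G} (f : OrderMap x₀ m g) :
    (f.inverse.concat f).toMap.HomotopicRel (OrderMap.const (G := G) x₀ m).toMap
      (cylEnds (Torus m)) := by
  have E : ∀ t, (f.inverse.concat f).toMap (1, t) = x₀ := fun t => by
    rw [OrderMap.map_one, inv_mul_cancel, one_smul]
  have k0 : ∀ t, translate g⁻¹ f.toMap (0, t) = g⁻¹ • x₀ :=
    fun t => congrArg (g⁻¹ • ·) (f.map_zero t)
  have k1 : ∀ t, translate g⁻¹ f.toMap (1, t) = x₀ := fun t => by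
    change g⁻¹ • f.toMap (1, t) = x₀
    rw [f.map_one, inv_smul_smul]
  rw [← homotopic_pathOf_iff (x := x₀) (y := x₀) (OrderMap.map_zero _)
      E (fun _ => rfl) (fun _ => rfl),
    pathOf_concat (b := (g⁻¹ • x₀)) _ _ _ _ (OrderMap.map_zero _)
      (OrderMap.map_one _) k0 k1]
  exact ⟨(Path.Homotopy.reflSymmTrans (pathOf (translate g⁻¹ f.toMap) k0 k1)).symm⟩

/-- The group structure `[f'; g'] * [f; g] = [f' + g' f; g' g]`. -/
instance RhodesGroup.instGroup (x₀ : X) (m : ℕ) : Group (RhodesGroup G x₀ m) :=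
  letI : Mul (RhodesGroup G x₀ m) :=
    ⟨fun a b => ⟨a.1 * b.1, Quotient.map₂ OrderMap.concat
      (fun _ _ h' _ _ h => OrderMap.concat_congr h' h) a.2 b.2⟩⟩
  letI : One (RhodesGroup G x₀ m) := ⟨RhodesGroup.mk (OrderMap.const x₀ m)⟩
  letI : Inv (RhodesGroup G x₀ m) :=
    ⟨fun a => ⟨a.1⁻¹, Quotient.map OrderMap.inverse (fun f k h => by
      obtain ⟨H⟩ := h
      refine ⟨⟨⟨⟨fun p => a.1⁻¹ • H (p.1, (σ p.2.1, p.2.2)), by fun_prop⟩, ?_, ?_⟩, ?_⟩⟩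
      · intro p
        exact congrArg (a.1⁻¹ • ·) (H.apply_zero _)
      · intro p
        exact congrArg (a.1⁻¹ • ·) (H.apply_one _)
      · rintro u ⟨s, t⟩ hs
        refine congrArg (a.1⁻¹ • ·) (H.eq_fst u ?_)
        rcases hs with (rfl | rfl : s = 0 ∨ s = 1)
        · exact Or.inr unitInterval.symm_zero
        · exact Or.inl unitInterval.symm_one) a.2⟩⟩
  Group.ofLeftAxioms
    (fun a b c => by
      induction a using RhodesGroup.ind with | h g₁ f₁ => ?_
      induction b using RhodesGroup.ind with | h g₂ f₂ => ?_
      induction c using RhodesGroup.ind with | h g₃ f₃ => ?_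
      exact RhodesGroup.mk_eq_mk (mul_assoc _ _ _) (OrderMap.concat_assoc f₁ f₂ f₃))
    (fun a => by
      induction a using RhodesGroup.ind with | h g f => ?_
      exact RhodesGroup.mk_eq_mk (one_mul _) (OrderMap.const_concat f))
    (fun a => by
      induction a using RhodesGroup.ind with | h g f => ?_
      exact RhodesGroup.mk_eq_mk (inv_mul_cancel _) (OrderMap.inverse_concat f))

theorem RhodesGroup.mk_mul_mk {x₀ : X} {m : ℕ} {g' g : G} (f' : OrderMap x₀ m g')
    (f : OrderMap x₀ m g) :
    RhodesGroup.mk f' * RhodesGroup.mk f = RhodesGroup.mk (f'.concat f) := rfl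

theorem RhodesGroup.one_def (x₀ : X) (m : ℕ) :
    (1 : RhodesGroup G x₀ m) = RhodesGroup.mk (OrderMap.const x₀ m) := rfl

variable (G) in
/-- The homomorphism `σ_(m+1)(X, x₀, G) → G`, `[f; g] ↦ g`. -/
def RhodesGroup.order (x₀ : X) (m : ℕ) : RhodesGroup G x₀ m →* G where
  toFun a := a.1
  map_one' := rfl
  map_mul' _ _ := rfl

/-! ### Change of torus: the projection `σ_n → σ_(n-1)` and its section -/

/-- The map `f ∘ (id × φ) : I × T^k → X` for a map `φ : T^k → T^m`. -/
def OrderMap.pullback {x₀ : X} {k m : ℕ} (φ : C(Torus k, Torus m)) {g : G}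
    (f : OrderMap x₀ m g) : OrderMap x₀ k g where
  toMap := f.toMap.comp ((ContinuousMap.id I).prodMap φ)
  map_zero t := f.map_zero (φ t)
  map_one t := f.map_one (φ t)

variable (G) in
/-- The homomorphism `[f; g] ↦ [f ∘ (id × φ); g]` induced by a map `φ : T^k → T^m`. -/
def RhodesGroup.pullback (x₀ : X) {k m : ℕ} (φ : C(Torus k, Torus m)) :
    RhodesGroup G x₀ m →* RhodesGroup G x₀ k :=
  MonoidHom.mk'
    (fun a => ⟨a.1, Quotient.map (OrderMap.pullback φ) (fun f f' h => by
      obtain ⟨H⟩ := h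
      refine ⟨⟨⟨⟨fun p => H (p.1, (p.2.1, φ p.2.2)), by fun_prop⟩, ?_, ?_⟩, ?_⟩⟩
      · intro p
        exact H.apply_zero _
      · intro p
        exact H.apply_one _
      · rintro u ⟨s, t⟩ hs
        exact H.eq_fst u hs) a.2⟩)
    (fun a b => by
      induction a using RhodesGroup.ind with | h g₁ f₁ => ?_
      induction b using RhodesGroup.ind with | h g₂ f₂ => ?_
      rfl)

variable (G) in
/-- The projection `σ_(m+2) → σ_(m+1)`, `[f; g] ↦ [f ∘ i; g]`, where
`i(t₁, …, t_(m+1)) = (t₁, …, t_(m+1), 0)`. -/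
def RhodesGroup.proj (x₀ : X) (m : ℕ) : RhodesGroup G x₀ (m + 1) →* RhodesGroup G x₀ m :=
  RhodesGroup.pullback G x₀ (torusIncl m)

variable (G) in
/-- The section `σ_(m+1) → σ_(m+2)` induced by the projection `C_(m+2) → C_(m+1)` that forgets
the last coordinate. -/
def RhodesGroup.sec (x₀ : X) (m : ℕ) : RhodesGroup G x₀ m →* RhodesGroup G x₀ (m + 1) :=
  RhodesGroup.pullback G x₀ (torusProj m)

/-! ### Fox's torus homotopy groups -/

section Fox

variable {Y Z : Type*} [TopologicalSpace Y] [TopologicalSpace Z]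

/-- The torus homotopy group `τ_(m+1)(Y, y₀)`: the fundamental group of the function space
`Y^(T^m)` at the constant map. In Mathlib's `FundamentalGroup` the product `p * q` is the path
`q` followed by `p`; passing to the opposite group gives the usual order, in which `p * q` is `p`
followed by `q`. -/
abbrev TorusGroup (y₀ : Y) (m : ℕ) : Type _ :=
  (FundamentalGroup C(Torus m, Y) (ContinuousMap.const _ y₀))ᵐᵒᵖ

/-- The class in `τ_(m+1)(Y, y₀)` of a loop in `Y^(T^m)`. -/
def TorusGroup.mk {y₀ : Y} {m : ℕ}
    (γ : Path (ContinuousMap.const (Torus m) y₀) (ContinuousMap.const (Torus m) y₀)) :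
    TorusGroup y₀ m :=
  MulOpposite.op (FundamentalGroup.fromPath (Path.Homotopic.Quotient.mk γ))

/-- The homomorphism `τ_(m+1)(Y, y₀) → τ_(k+1)(Z, z₀)` induced by a based map of function spaces
`Y^(T^m) → Z^(T^k)`. -/
def TorusGroup.map {y₀ : Y} {z₀ : Z} {m k : ℕ} (F : C(C(Torus m, Y), C(Torus k, Z)))
    (hF : F (.const _ y₀) = .const _ z₀) : TorusGroup y₀ m →* TorusGroup z₀ k :=
  MonoidHom.op (FundamentalGroup.mapOfEq F hF)

/-- The projection `τ_(m+2) → τ_(m+1)`, restriction along `i : T^m → T^(m+1)`. -/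
def TorusGroup.proj (y₀ : Y) (m : ℕ) : TorusGroup y₀ (m + 1) →* TorusGroup y₀ m :=
  TorusGroup.map ⟨fun u => u.comp (torusIncl m), by fun_prop⟩ rfl

/-- The section `τ_(m+1) → τ_(m+2)` induced by the projection `T^(m+1) → T^m`. -/
def TorusGroup.sec (y₀ : Y) (m : ℕ) : TorusGroup y₀ m →* TorusGroup y₀ (m + 1) :=
  TorusGroup.map ⟨fun u => u.comp (torusProj m), by fun_prop⟩ rfl

/-- A loop `γ : I → Y` at `y₀` as a function on `ℝ/ℤ`, `[u] ↦ γ(u)` for `0 ≤ u < 1`. -/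
def loopEval (y₀ : Y) (p : LoopSpace Y y₀ × UnitAddCircle) : Y :=
  p.1 ⟨AddCircle.equivIco 1 0 p.2, by
    have h := (AddCircle.equivIco (1 : ℝ) 0 p.2).2
    exact ⟨h.1, by simpa using h.2.le⟩⟩

theorem loopEval_coe (y₀ : Y) (γ : LoopSpace Y y₀) (u : I) :
    loopEval y₀ (γ, ((u : ℝ) : UnitAddCircle)) = γ u := by
  by_cases hu : (u : ℝ) < 1
  · unfold loopEval
    congr 1
    apply Subtype.ext
    have := AddCircle.equivIco_coe_of_mem (p := (1 : ℝ)) (a := 0) (y := (u : ℝ))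
      ⟨u.2.1, by simpa using hu⟩
    simpa using this
  · have h1 : u = 1 := Subtype.ext (le_antisymm u.2.2 (not_lt.1 hu))
    subst h1
    have h0 : (((1 : I) : ℝ) : UnitAddCircle) = ((0 : ℝ) : UnitAddCircle) := by
      simp [AddCircle.coe_period]
    rw [h0, γ.target]
    unfold loopEval
    have := AddCircle.equivIco_coe_of_mem (p := (1 : ℝ)) (a := 0) (y := (0 : ℝ))
      ⟨le_rfl, by simp⟩
    have h2 : (⟨AddCircle.equivIco 1 0 ((0 : ℝ) : UnitAddCircle), by
      rw [this]; exact ⟨le_rfl, zero_le_one⟩⟩ : I) = 0 := Subtype.ext this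
    exact (congrArg γ h2).trans γ.source

theorem continuous_loopEval (y₀ : Y) : Continuous (loopEval y₀) := by
  have hq : Continuous (fun u : I => ((u : ℝ) : UnitAddCircle)) :=
    (AddCircle.continuous_mk' 1).comp continuous_subtype_val
  have hs : Function.Surjective (fun u : I => ((u : ℝ) : UnitAddCircle)) := by
    intro θ
    have h := (AddCircle.equivIco (1 : ℝ) 0 θ).2
    exact ⟨⟨AddCircle.equivIco 1 0 θ, h.1, by simpa using h.2.le⟩,
      AddCircle.coe_equivIco⟩
  have hp : IsProperMap (Prod.map (id : LoopSpace Y y₀ → _)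
      (fun u : I => ((u : ℝ) : UnitAddCircle))) :=
    isProperMap_id.prodMap hq.isProperMap
  have hQ := hp.isClosedMap.isQuotientMap hp.continuous (Function.surjective_id.prodMap hs)
  rw [hQ.continuous_iff]
  have : (loopEval y₀ ∘ Prod.map (id : LoopSpace Y y₀ → _)
      (fun u : I => ((u : ℝ) : UnitAddCircle))) = fun p => p.1 p.2 := by
    ext ⟨γ, u⟩
    exact loopEval_coe y₀ γ u
  rw [this]
  fun_prop

/-- The adjunction `(ΩY)^(T^m) → Y^(T^(m+1))`, `h ↦ ((t₁, …, t_m, [u]) ↦ h(t₁, …, t_m)(u))`. -/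
def loopAdj (y₀ : Y) (m : ℕ) : C(C(Torus m, LoopSpace Y y₀), C(Torus (m + 1), Y)) :=
  ContinuousMap.curry
    ⟨fun p => loopEval y₀ (p.1 (torusProj m p.2), p.2 (Fin.last m)),
      (continuous_loopEval y₀).comp (by fun_prop)⟩

/-- The homomorphism `τ_(m+1)(ΩY, ȳ₀) → τ_(m+2)(Y, y₀)` given by adjunction; `ȳ₀` is the constant
loop. -/
def TorusGroup.ofLoop (y₀ : Y) (m : ℕ) :
    TorusGroup (Path.refl y₀ : LoopSpace Y y₀) m →* TorusGroup y₀ (m + 1) :=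
  TorusGroup.map (loopAdj y₀ m) rfl

end Fox

variable (G) in
/-- The map of order `1` adjoint to a loop in `X^(T^m)` based at the constant map. -/
def OrderMap.ofLoop {x₀ : X} {m : ℕ}
    (γ : Path (ContinuousMap.const (Torus m) x₀) (ContinuousMap.const (Torus m) x₀)) :
    OrderMap x₀ m (1 : G) where
  toMap := γ.toContinuousMap.uncurry
  map_zero t := DFunLike.congr_fun γ.source t
  map_one t := by
    rw [one_smul]
    exact DFunLike.congr_fun γ.target t

variable (G) in
/-- The homomorphism `τ_(m+1)(X, x₀) → σ_(m+1)(X, x₀, G)`, `[f] ↦ [f; 1]`. -/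
def RhodesGroup.ofTorus (x₀ : X) (m : ℕ) : TorusGroup x₀ m →* RhodesGroup G x₀ m :=
  MonoidHom.mk'
    (fun a => Quotient.lift (fun γ => RhodesGroup.mk (OrderMap.ofLoop G γ))
      (fun γ γ' h => RhodesGroup.mk_eq_mk rfl
        ((homotopic_pathOf_iff (fun t => DFunLike.congr_fun γ.source t)
          (fun t => DFunLike.congr_fun γ.target t) (fun t => DFunLike.congr_fun γ'.source t)
          (fun t => DFunLike.congr_fun γ'.target t)).1 h))
      (FundamentalGroup.toPath a.unop))
    (fun a b => by
      induction a using MulOpposite.rec' with | h a => ?_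
      induction b using MulOpposite.rec' with | h b => ?_
      induction a using Quotient.inductionOn with | h γ => ?_
      induction b using Quotient.inductionOn with | h δ => ?_
      refine RhodesGroup.mk_eq_mk (one_mul _).symm ?_
      have e : (OrderMap.ofLoop G (γ.trans δ)).toMap
          = ((OrderMap.ofLoop G γ).concat (OrderMap.ofLoop G δ)).toMap := by
        ext ⟨s, t⟩
        change γ.trans δ s t = (if (s : ℝ) ≤ 1 / 2 then (_ : X) else (1 : G) • _)
        simp only [Path.trans, Path.coe_mk', ContinuousMap.coe_mk, Function.comp_apply]
        rw [one_smul]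
        split_ifs <;> rfl
      exact (congrArg (fun k => ContinuousMap.HomotopicRel
        (OrderMap.ofLoop G (γ.trans δ)).toMap k (cylEnds (Torus m))) e).mp (.refl _))

variable (G) in
theorem RhodesGroup.ofTorus_mk {x₀ : X} {m : ℕ}
    (γ : Path (ContinuousMap.const (Torus m) x₀) (ContinuousMap.const (Torus m) x₀)) :
    RhodesGroup.ofTorus G x₀ m (TorusGroup.mk γ) = RhodesGroup.mk (OrderMap.ofLoop G γ) := rfl

variable (G) in
/-- The homomorphism `τ_(m+1)(ΩX, x̄₀) → σ_(m+2)(X, x₀, G)`: the class of `h : I × T^m → ΩX` goes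
to `[f; 1]` with `f(s, t₁, …, t_m, [u]) = h(s, t₁, …, t_m)(u)`. -/
def RhodesGroup.ofLoop (x₀ : X) (m : ℕ) :
    TorusGroup (Path.refl x₀ : LoopSpace X x₀) m →* RhodesGroup G x₀ (m + 1) :=
  (RhodesGroup.ofTorus G x₀ (m + 1)).comp (TorusGroup.ofLoop x₀ m)

end RhodesTheory

end

/-! Restricting a map `T^(m+1) → Y` to last coordinate zero sends a `T^m`-family of free loops to
its family of base points. The fibre of this restriction over the constant map is `(ΩY)^(T^m)`, and
constant free loops give a section. For a fibration with a section the long exact homotopy sequence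
breaks into split short exact pieces; Fox's sequence is the piece on `π₁`.

The two substantial points are settled by explicit homotopies. For injectivity
(`homotopic_refl_of_loopAdj`), a free contraction of a based loop deforms it, rel base point, into
the track of its base point run forward and then back, and this contracts along itself. For
exactness in the middle (`exists_homotopic_loopAdj`), a contraction of the base points supplies
tails; attaching them at both ends of the free loops makes these based.

The Rhodes sequence follows by a diagram chase. The projection does not change `g`, so its kernel
lies over `1 ∈ G`, and there `RhodesGroup.ofTorus` identifies the Rhodes group with Fox's group
(`RhodesGroup.ofTorus_injective`, `RhodesGroup.range_ofTorus`), compatibly with the projections. -/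

namespace RhodesTheory

/-! ### Descent from the interval to the circle, and families of based loops. -/

section Descent

variable {A Y : Type*} [TopologicalSpace A] [TopologicalSpace Y]

theorem surjective_unitInterval_coe :
    Function.Surjective (fun u : I => ((u : ℝ) : UnitAddCircle)) := fun θ =>
  have h := (AddCircle.equivIco (1 : ℝ) 0 θ).2
  ⟨⟨AddCircle.equivIco 1 0 θ, h.1, by simpa using h.2.le⟩, AddCircle.coe_equivIco⟩

/-- A family of maps on the unit interval whose values at `0` and `1` agree descends to a family
of maps on the circle. -/
theorem exists_circle_descent (F : C(A × I, Y)) (h : ∀ a, F (a, 0) = F (a, 1)) :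
    ∃ F' : C(A × UnitAddCircle, Y), ∀ a (u : I), F' (a, ((u : ℝ) : UnitAddCircle)) = F (a, u) := by
  have hq : Continuous (fun u : I => ((u : ℝ) : UnitAddCircle)) :=
    (AddCircle.continuous_mk' 1).comp continuous_subtype_val
  -- The product of a quotient map with an identity need not be a quotient map. Here `I` is compact
  -- and the circle Hausdorff, so `q` is proper and `id × q` is closed for every space `A`.
  have hp : IsProperMap (Prod.map (id : A → A) (fun u : I => ((u : ℝ) : UnitAddCircle))) :=
    isProperMap_id.prodMap hq.isProperMap
  have hQ := hp.isClosedMap.isQuotientMap hp.continuous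
    (Function.surjective_id.prodMap surjective_unitInterval_coe)
  let e (θ : UnitAddCircle) : I := ⟨AddCircle.equivIco 1 0 θ, by
    have h := (AddCircle.equivIco (1 : ℝ) 0 θ).2
    exact ⟨h.1, by simpa using h.2.le⟩⟩
  have key (a : A) (u : I) : F (a, e ((u : ℝ) : UnitAddCircle)) = F (a, u) := by
    have hv (v : I) (hv : (v : ℝ) < 1) : e ((v : ℝ) : UnitAddCircle) = v := Subtype.ext <|
      AddCircle.equivIco_coe_of_mem (p := (1 : ℝ)) (a := 0) (y := (v : ℝ))
        ⟨v.2.1, by simpa using hv⟩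
    by_cases hu : (u : ℝ) < 1
    · rw [hv u hu]
    -- Representatives are taken in `[0, 1)`, so `e` sends the class of `1` to `0`; only here does
    -- `h` enter.
    · obtain rfl : u = 1 := Subtype.ext (le_antisymm u.2.2 (not_lt.1 hu))
      have h0 : (((1 : I) : ℝ) : UnitAddCircle) = (((0 : I) : ℝ) : UnitAddCircle) := by
        simp [AddCircle.coe_period]
      rw [h0, hv 0 (by simp), h]
  refine ⟨⟨fun p => F (p.1, e p.2), ?_⟩, key⟩
  rw [hQ.continuous_iff]
  have : (fun p : A × UnitAddCircle => F (p.1, e p.2)) ∘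
      Prod.map (id : A → A) (fun u : I => ((u : ℝ) : UnitAddCircle)) = F := by
    ext ⟨a, u⟩
    exact key a u
  rw [this]
  exact F.continuous

/-- A continuous family of maps `T^m → ΩY` given by its values. -/
def loopFamily (y₀ : Y) (m : ℕ) (F : C((A × Torus m) × I, Y)) (h0 : ∀ p, F (p, 0) = y₀)
    (h1 : ∀ p, F (p, 1) = y₀) : C(A, C(Torus m, LoopSpace Y y₀)) :=
  ContinuousMap.curry
    ⟨fun p => { toFun := fun u => F (p, u), source' := h0 p, target' := h1 p },
      Path.continuous_uncurry_iff.1 (F.continuous.comp (by fun_prop))⟩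

theorem homotopic_of_square {x y : Y} {p q : Path x y} (Φ : C(I × I, Y))
    (h0 : ∀ s, Φ (0, s) = p s) (h1 : ∀ s, Φ (1, s) = q s) (hs : ∀ r, Φ (r, 0) = x)
    (ht : ∀ r, Φ (r, 1) = y) : p.Homotopic q :=
  ⟨⟨⟨Φ, h0, h1⟩, by
    rintro r s (rfl | rfl)
    · exact (hs r).trans p.source.symm
    · exact (ht r).trans p.target.symm⟩⟩

end Descent

/-! ### Splitting off the last circle of a torus. -/

section Torus

/-- The homeomorphism `T^m × ℝ/ℤ → T^(m+1)`, as a continuous map. -/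
def torusSnoc (m : ℕ) : C(Torus m × UnitAddCircle, Torus (m + 1)) where
  toFun p := Fin.snoc (α := fun _ => UnitAddCircle) p.1 p.2
  continuous_toFun := Continuous.finSnoc (A := fun _ => UnitAddCircle) continuous_fst continuous_snd

theorem torusSnoc_proj_last {m : ℕ} (t : Torus (m + 1)) :
    torusSnoc m (torusProj m t, t (Fin.last m)) = t :=
  Fin.snoc_init_self (α := fun _ => UnitAddCircle) t

theorem torusSnoc_zero {m : ℕ} (t : Torus m) : torusSnoc m (t, 0) = torusIncl m t := rfl

/-- Reduces identities between maps on `T^(m+1)` to points whose last coordinate is given by a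
parameter in `I`, where `loopAdj` and descended maps have explicit values. -/
theorem exists_torusSnoc_eq {m : ℕ} (t : Torus (m + 1)) :
    ∃ (t' : Torus m) (u : I), torusSnoc m (t', ((u : ℝ) : UnitAddCircle)) = t := by
  obtain ⟨u, hu⟩ := surjective_unitInterval_coe (t (Fin.last m))
  exact ⟨torusProj m t, u, by simpa only [hu] using torusSnoc_proj_last t⟩

variable {Y : Type*} [TopologicalSpace Y]

theorem loopAdj_torusSnoc {y₀ : Y} {m : ℕ} (h : C(Torus m, LoopSpace Y y₀)) (t : Torus m) (u : I) :
    loopAdj y₀ m h (torusSnoc m (t, ((u : ℝ) : UnitAddCircle))) = h t u := by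
  have h1 : torusProj m (torusSnoc m (t, ((u : ℝ) : UnitAddCircle))) = t := by
    ext i; simp [torusProj, torusSnoc]
  have h2 : torusSnoc m (t, ((u : ℝ) : UnitAddCircle)) (Fin.last m) = ((u : ℝ) : UnitAddCircle) := by
    simp [torusSnoc]
  change loopEval y₀ (h (torusProj m _), torusSnoc m _ (Fin.last m)) = _
  rw [h1, h2, loopEval_coe]

end Torus

/-! ### Loops in function spaces and their images. -/

section Paths

variable {A B Y : Type*} [TopologicalSpace A] [TopologicalSpace B] [TopologicalSpace Y]

/-- The image of a loop at `a` under a continuous map that takes `a` to `b`. -/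
def mapLoop (F : C(A, B)) {a : A} {b : B} (hF : F a = b) (γ : Path a a) : Path b b :=
  (γ.map F.continuous).cast hF.symm hF.symm

/-- The map of function spaces given by precomposition. -/
def precomp (Y : Type*) [TopologicalSpace Y] (φ : C(A, B)) : C(C(B, Y), C(A, Y)) :=
  ⟨fun u => u.comp φ, by fun_prop⟩

theorem mapLoop_apply (F : C(A, B)) {a : A} {b : B} (hF : F a = b) (γ : Path a a) (s : I) :
    mapLoop F hF γ s = F (γ s) := rfl

theorem precomp_apply (φ : C(A, B)) (u : C(B, Y)) (a : A) : precomp Y φ u a = u (φ a) := rfl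

end Paths

/-! ### Torus homotopy groups through representing loops. -/

section TorusGroup

variable {Y Z : Type*} [TopologicalSpace Y] [TopologicalSpace Z]

theorem TorusGroup.mk_surjective {y₀ : Y} {m : ℕ} (a : TorusGroup y₀ m) :
    ∃ γ, TorusGroup.mk γ = a := by
  induction a using MulOpposite.rec' with | h a => ?_
  induction a using Quotient.inductionOn with | h γ => exact ⟨γ, rfl⟩

theorem TorusGroup.mk_eq_mk {y₀ : Y} {m : ℕ}
    {γ δ : Path (ContinuousMap.const (Torus m) y₀) (ContinuousMap.const (Torus m) y₀)} :
    TorusGroup.mk γ = TorusGroup.mk δ ↔ γ.Homotopic δ :=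
  MulOpposite.op_injective.eq_iff.trans Path.Homotopic.Quotient.eq

theorem TorusGroup.one_def (y₀ : Y) (m : ℕ) :
    (1 : TorusGroup y₀ m) = TorusGroup.mk (Path.refl _) := rfl

theorem TorusGroup.map_mk {y₀ : Y} {z₀ : Z} {m k : ℕ} (F : C(C(Torus m, Y), C(Torus k, Z)))
    (hF : F (.const _ y₀) = .const _ z₀)
    (γ : Path (ContinuousMap.const (Torus m) y₀) (ContinuousMap.const (Torus m) y₀)) :
    TorusGroup.map F hF (TorusGroup.mk γ)
      = TorusGroup.mk (mapLoop F hF γ) :=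
  congrArg MulOpposite.op (FundamentalGroup.mapOfEq_apply F hF _)

/-! ### Exactness of Fox's sequence -/

theorem TorusGroup.ofLoop_mk {y₀ : Y} {m : ℕ}
    (γ : Path (ContinuousMap.const (Torus m) (Path.refl y₀ : LoopSpace Y y₀))
      (ContinuousMap.const (Torus m) (Path.refl y₀ : LoopSpace Y y₀))) :
    TorusGroup.ofLoop y₀ m (TorusGroup.mk γ) = TorusGroup.mk (mapLoop (loopAdj y₀ m) rfl γ) :=
  TorusGroup.map_mk _ _ γ

theorem TorusGroup.proj_mk {y₀ : Y} {m : ℕ}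
    (γ : Path (ContinuousMap.const (Torus (m + 1)) y₀) (ContinuousMap.const (Torus (m + 1)) y₀)) :
    TorusGroup.proj y₀ m (TorusGroup.mk γ)
      = TorusGroup.mk (mapLoop (precomp Y (torusIncl m)) rfl γ) :=
  TorusGroup.map_mk _ _ γ

theorem TorusGroup.sec_mk {y₀ : Y} {m : ℕ}
    (γ : Path (ContinuousMap.const (Torus m) y₀) (ContinuousMap.const (Torus m) y₀)) :
    TorusGroup.sec y₀ m (TorusGroup.mk γ)
      = TorusGroup.mk (mapLoop (precomp Y (torusProj m)) rfl γ) :=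
  TorusGroup.map_mk _ _ γ

/-- If the loops of `γ` are contractible as free loops, then they are contractible as based loops:
the straight-line homotopy in the square moves the based side to the other three sides. -/
theorem homotopic_refl_of_loopAdj {y₀ : Y} {m : ℕ}
    (γ : Path (ContinuousMap.const (Torus m) (Path.refl y₀ : LoopSpace Y y₀))
      (ContinuousMap.const (Torus m) (Path.refl y₀ : LoopSpace Y y₀)))
    (h : (mapLoop (loopAdj y₀ m) rfl γ).Homotopic (Path.refl _)) :
    γ.Homotopic (Path.refl _) := by
  obtain ⟨K⟩ := h
  have K0 (s : I) (t : Torus m) (u : I) :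
      K (0, s) (torusSnoc m (t, ((u : ℝ) : UnitAddCircle))) = γ s t u := by
    rw [K.apply_zero]
    exact loopAdj_torusSnoc _ _ _
  have K1 (s : I) (t) : K (1, s) t = y₀ := by rw [K.apply_one]; rfl
  have Ks (r : I) (t) : K (r, 0) t = y₀ := by rw [K.source]; rfl
  have Kt (r : I) (t) : K (r, 1) t = y₀ := by rw [K.target]; rfl
  have K00 (s : I) (t : Torus m) : K (0, s) (torusSnoc m (t, 0)) = y₀ := by
    have := K0 s t 0
    rw [(γ s t).source] at this
    simpa using this
  -- For fixed `s` and `t`, `K` is a map on a square with coordinates `r` (homotopy) and `u` (loop).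
  -- The curve `(e u, c u)` goes up the side `u = 0`, across `r = 1` and down the side `u = 1`, one
  -- third of the time each.
  let e : C(I, I) := ⟨fun u => Set.projIcc 0 1 zero_le_one (min (3 * (u : ℝ)) (3 - 3 * u)),
    continuous_projIcc.comp (by fun_prop)⟩
  let c : C(I, ℝ) := ⟨fun u => max 0 (min 1 (3 * (u : ℝ) - 1)), by fun_prop⟩
  have e0 : e 0 = 0 := by simp [e]
  have e1 : e 1 = 0 := by simp [e]
  have c0 : c 0 = 0 := by simp [c]
  have c1 : c 1 = 1 := by norm_num [c]
  -- Each point of the curve is on the top edge, where `K` is constant, or on a vertical side, where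
  -- the circle coordinate is zero.
  have hec (u : I) : e u = 1 ∨ (c u : UnitAddCircle) = 0 := by
    rcases le_total (3 * (u : ℝ)) 1 with hu | hu
    · right
      have : c u = 0 := by
        change max 0 (min 1 (3 * (u : ℝ) - 1)) = 0
        exact max_eq_left ((min_le_right _ _).trans (by linarith))
      rw [this]; rfl
    rcases le_total (3 * (u : ℝ)) 2 with hu' | hu'
    · left
      exact Set.projIcc_of_right_le zero_le_one (le_min hu (by linarith))
    · right
      have : c u = 1 := by
        change max 0 (min 1 (3 * (u : ℝ) - 1)) = 1
        rw [min_eq_left (by linarith), max_eq_right zero_le_one]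
      rw [this]
      exact AddCircle.coe_period 1
  have hmk : Continuous (fun x : ℝ => (x : UnitAddCircle)) := AddCircle.continuous_mk' 1
  -- The segment in the square from `(0, u)` to `(e u, c u)`. Both curves have the same end points,
  -- so the loops stay based.
  let F₁ : C(((I × I) × Torus m) × I, Y) :=
    ⟨fun p => K (p.1.1.1 * e p.2, p.1.1.2) (torusSnoc m (p.1.2,
      (((1 - (p.1.1.1 : ℝ)) * p.2 + p.1.1.1 * c p.2 : ℝ) : UnitAddCircle))), by fun_prop⟩
  -- The three-sided curve has become `u ↦ K (e u, s)` on the zero slice, a path run out and back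
  -- because `e 0 = e 1 = 0`. Scaling `e` down to `0` retracts it.
  let F₂ : C(((I × I) × Torus m) × I, Y) :=
    ⟨fun p => K (σ p.1.1.1 * e p.2, p.1.1.2) (torusSnoc m (p.1.2, 0)), by fun_prop⟩
  have F₁0 (p) : F₁ (p, 0) = y₀ := by
    simpa [F₁, e0, c0] using K00 p.1.2 p.2
  have F₁1 (p) : F₁ (p, 1) = y₀ := by
    have : ((1 : ℝ) : UnitAddCircle) = 0 := AddCircle.coe_period 1
    simpa [F₁, e1, c1, this] using K00 p.1.2 p.2
  have F₂0 (p) : F₂ (p, 0) = y₀ := by simpa [F₂, e0] using K00 p.1.2 p.2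
  have F₂1 (p) : F₂ (p, 1) = y₀ := by simpa [F₂, e1] using K00 p.1.2 p.2
  let L₁ := loopFamily y₀ m F₁ F₁0 F₁1
  let L₂ := loopFamily y₀ m F₂ F₂0 F₂1
  have L₁s (r : I) : L₁ (r, 0) = .const _ (Path.refl y₀) := by
    ext t u; exact Ks _ _
  have L₁t (r : I) : L₁ (r, 1) = .const _ (Path.refl y₀) := by
    ext t u; exact Kt _ _
  have L₂s (r : I) : L₂ (r, 0) = .const _ (Path.refl y₀) := by
    ext t u; exact Ks _ _
  have L₂t (r : I) : L₂ (r, 1) = .const _ (Path.refl y₀) := by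
    ext t u; exact Kt _ _
  let δ : Path (ContinuousMap.const (Torus m) (Path.refl y₀ : LoopSpace Y y₀))
      (ContinuousMap.const (Torus m) (Path.refl y₀ : LoopSpace Y y₀)) :=
    { toFun := fun s => L₁ (1, s)
      source' := L₁s 1
      target' := L₁t 1 }
  have h₁ : γ.Homotopic δ := by
    refine homotopic_of_square L₁ (fun s => ?_) (fun s => rfl) L₁s L₁t
    ext t u
    change K (0 * e u, s) (torusSnoc m (t, _)) = _
    rw [← K0]
    simp
  have h₂ : δ.Homotopic (Path.refl _) := by
    refine homotopic_of_square L₂ (fun s => ?_) (fun s => ?_) L₂s L₂t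
    · ext t u
      change K (σ 0 * e u, s) (torusSnoc m (t, 0)) = K (1 * e u, s) (torusSnoc m (t, _))
      rw [unitInterval.symm_zero, one_mul]
      -- `δ` uses the coordinate `c u` while `F₂` uses `0`; this makes no difference on the top
      -- edge, and elsewhere the two classes coincide.
      rcases hec u with h | h
      · rw [h, K1, K1]
      · simp [h]
    · ext t u
      change K (σ 1 * e u, s) (torusSnoc m (t, 0)) = y₀
      rw [unitInterval.symm_one, zero_mul, K00]
  exact h₁.trans h₂

/-- A loop of free loops whose base points can be contracted is homotopic to a loop of based
loops: the free loops are conjugated by the paths of their base points. -/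
theorem exists_homotopic_loopAdj {y₀ : Y} {m : ℕ}
    (γ : Path (ContinuousMap.const (Torus (m + 1)) y₀) (ContinuousMap.const (Torus (m + 1)) y₀))
    (h : (mapLoop (precomp Y (torusIncl m)) rfl γ).Homotopic
      (Path.refl (ContinuousMap.const (Torus m) y₀))) :
    ∃ δ : Path (ContinuousMap.const (Torus m) (Path.refl y₀ : LoopSpace Y y₀))
      (ContinuousMap.const (Torus m) (Path.refl y₀ : LoopSpace Y y₀)),
      γ.Homotopic (mapLoop (loopAdj y₀ m) rfl δ) := by
  obtain ⟨H⟩ := h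
  have H0 (s : I) (t : Torus m) : H (0, s) t = γ s (torusSnoc m (t, 0)) := by
    rw [H.apply_zero]; rfl
  have H1 (s : I) (t) : H (1, s) t = y₀ := by rw [H.apply_one]; rfl
  have Hs (r : I) (t) : H (r, 0) t = y₀ := by rw [H.source]; rfl
  have Ht (r : I) (t) : H (r, 1) t = y₀ := by rw [H.target]; rfl
  have γs (t) : γ 0 t = y₀ := by rw [γ.source]; rfl
  have γt (t) : γ 1 t = y₀ := by rw [γ.target]; rfl
  let pr : ℝ → I := Set.projIcc 0 1 zero_le_one
  have hpr : Continuous pr := continuous_projIcc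
  have pr0 : pr 0 = 0 := Set.projIcc_left _
  have pr_coe (u : I) : pr u = u := Set.projIcc_val _ u
  have hmk : Continuous (fun x : ℝ => (x : UnitAddCircle)) := AddCircle.continuous_mk' 1
  -- The free loop on `[0, 1]`, extended on both sides by the track of its base point under `H`. The
  -- pieces agree at `0` and `1` since `H` starts at the base points of `γ`.
  let E : C((I × Torus m) × ℝ, Y) :=
    { toFun := fun p => if p.2 ≤ 0 then H (pr (-p.2), p.1.1) p.1.2 else
        if 1 ≤ p.2 then H (pr (p.2 - 1), p.1.1) p.1.2
        else γ p.1.1 (torusSnoc m (p.1.2, (p.2 : UnitAddCircle)))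
      continuous_toFun := by
        refine Continuous.if_le (by fun_prop) (Continuous.if_le (by fun_prop) (by fun_prop)
          (by fun_prop) (by fun_prop) ?_) (by fun_prop) (by fun_prop) ?_
        · rintro ⟨⟨s, t⟩, v⟩ (rfl : 1 = v)
          have : ((1 : ℝ) : UnitAddCircle) = 0 := AddCircle.coe_period 1
          simp [pr0, torusSnoc_zero, mapLoop_apply, precomp_apply, this]
        · rintro ⟨⟨s, t⟩, v⟩ (rfl : v = 0)
          norm_num [pr0, torusSnoc_zero, mapLoop_apply, precomp_apply] }
  have E_neg (s t) (r : I) : E ((s, t), -(r : ℝ)) = H (r, s) t := by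
    change (if -(r : ℝ) ≤ 0 then H (pr (- -(r : ℝ)), s) t else _) = _
    rw [if_pos (by linarith [r.2.1]), neg_neg, pr_coe]
  have E_pos (s t) (r : I) : E ((s, t), 1 + (r : ℝ)) = H (r, s) t := by
    change (if 1 + (r : ℝ) ≤ 0 then (_ : Y) else if 1 ≤ 1 + (r : ℝ) then
      H (pr (1 + (r : ℝ) - 1), s) t else _) = _
    rw [if_neg (by linarith [r.2.1]), if_pos (by linarith [r.2.1]), add_sub_cancel_left, pr_coe]
  have E_mid (s t) (u : I) : E ((s, t), (u : ℝ))
      = γ s (torusSnoc m (t, ((u : ℝ) : UnitAddCircle))) := by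
    rcases u.2.1.eq_or_lt with hu | hu
    · obtain rfl : u = 0 := Subtype.ext hu.symm
      simpa [torusSnoc_zero, mapLoop_apply, precomp_apply] using E_neg s t 0
    rcases u.2.2.eq_or_lt with hu' | hu'
    · obtain rfl : u = 1 := Subtype.ext hu'
      have : ((1 : ℝ) : UnitAddCircle) = 0 := AddCircle.coe_period 1
      simpa [torusSnoc_zero, mapLoop_apply, precomp_apply, this] using E_pos s t 0
    · change (if (u : ℝ) ≤ 0 then (_ : Y) else if 1 ≤ (u : ℝ) then _ else _) = _
      rw [if_neg hu.not_ge, if_neg hu'.not_ge]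
  have Es (t) (v : ℝ) : E ((0, t), v) = y₀ := by
    change (if v ≤ 0 then (_ : Y) else if 1 ≤ v then _ else _) = _
    simp only [Hs, γs, ite_self]
  have Et (t) (v : ℝ) : E ((1, t), v) = y₀ := by
    change (if v ≤ 0 then (_ : Y) else if 1 ≤ v then _ else _) = _
    simp only [Ht, γt, ite_self]
  -- The affine map `u ↦ u(1 + 2r) - r` carries `[0, 1]` onto `[-r, 1 + r]`. At time `r` the loop
  -- has tails of length `r`, and both ends are `H (r, s) t`, so it closes up; at `r = 1` both ends
  -- are `y₀`.
  let F : C(((I × I) × Torus m) × I, Y) :=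
    ⟨fun p => E ((p.1.1.2, p.1.2), p.2 * (1 + 2 * (p.1.1.1 : ℝ)) - p.1.1.1), by fun_prop⟩
  have F0 (r s t) : F (((r, s), t), 0) = H (r, s) t := by
    rw [← E_neg]
    simp [F]
  have F1 (r s t) : F (((r, s), t), 1) = H (r, s) t := by
    rw [← E_pos]
    change E (_, _) = E (_, _)
    congr 2
    simp only [Set.Icc.coe_one]
    ring
  obtain ⟨F', hF'⟩ := exists_circle_descent F
    (by rintro ⟨⟨r, s⟩, t⟩; rw [F0, F1])
  let Φ : C(I × I, C(Torus (m + 1), Y)) :=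
    ContinuousMap.curry ⟨fun p => F' ((p.1, torusProj m p.2), p.2 (Fin.last m)), by fun_prop⟩
  have hΦ (a t) (u : I) : Φ a (torusSnoc m (t, ((u : ℝ) : UnitAddCircle))) = F ((a, t), u) := by
    rw [← hF']
    change F' ((a, torusProj m (torusSnoc m _)), torusSnoc m _ (Fin.last m)) = _
    congr 3
    · ext i; simp [torusProj, torusSnoc]
    · simp [torusSnoc]
  -- The slice `r = 1`, where the loops are based.
  let ι : C(I × Torus m, (I × I) × Torus m) := ⟨fun p => ((1, p.1), p.2), by fun_prop⟩
  let D : C(I, C(Torus m, LoopSpace Y y₀)) :=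
    loopFamily y₀ m (F.comp (ι.prodMap (.id I))) (fun p => (F0 _ _ _).trans (H1 _ _))
      (fun p => (F1 _ _ _).trans (H1 _ _))
  refine ⟨⟨D, ?_, ?_⟩, homotopic_of_square Φ (fun s => ?_) (fun s => ?_) (fun r => ?_)
    (fun r => ?_)⟩
  · ext t u; exact Es _ _
  · ext t u; exact Et _ _
  all_goals
    ext t
    obtain ⟨t, u, rfl⟩ := exists_torusSnoc_eq t
    rw [hΦ]
  · rw [← E_mid]
    simp [F]
  · exact (loopAdj_torusSnoc (D s) t u).symm
  · exact Es _ _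
  · exact Et _ _

theorem TorusGroup.ofLoop_injective (y₀ : Y) (m : ℕ) :
    Function.Injective (TorusGroup.ofLoop y₀ m) := by
  rw [injective_iff_map_eq_one]
  intro a ha
  obtain ⟨γ, rfl⟩ := TorusGroup.mk_surjective a
  rw [TorusGroup.ofLoop_mk, TorusGroup.one_def, TorusGroup.mk_eq_mk] at ha
  exact TorusGroup.mk_eq_mk.2 (homotopic_refl_of_loopAdj γ ha)

theorem TorusGroup.proj_ofLoop {y₀ : Y} {m : ℕ}
    (a : TorusGroup (Path.refl y₀ : LoopSpace Y y₀) m) :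
    TorusGroup.proj y₀ m (TorusGroup.ofLoop y₀ m a) = 1 := by
  obtain ⟨γ, rfl⟩ := TorusGroup.mk_surjective a
  rw [TorusGroup.ofLoop_mk, TorusGroup.proj_mk, TorusGroup.one_def]
  congr 1
  ext s t
  change loopAdj y₀ m (γ s) (torusIncl m t) = y₀
  -- Last coordinate zero evaluates each based loop at its start, so the projected loop is constant
  -- on the nose.
  have := loopAdj_torusSnoc (γ s) t 0
  rw [(γ s t).source] at this
  exact this

theorem TorusGroup.range_ofLoop (y₀ : Y) (m : ℕ) :
    (TorusGroup.ofLoop y₀ m).range = (TorusGroup.proj y₀ m).ker := by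
  ext a
  constructor
  · rintro ⟨b, rfl⟩
    exact TorusGroup.proj_ofLoop b
  · intro ha
    obtain ⟨γ, rfl⟩ := TorusGroup.mk_surjective a
    rw [MonoidHom.mem_ker, TorusGroup.proj_mk, TorusGroup.one_def, TorusGroup.mk_eq_mk] at ha
    obtain ⟨δ, hδ⟩ := exists_homotopic_loopAdj γ ha
    exact ⟨TorusGroup.mk δ, (TorusGroup.ofLoop_mk δ).trans (TorusGroup.mk_eq_mk.2 hδ.symm)⟩

theorem torusProj_torusIncl {m : ℕ} (t : Torus m) : torusProj m (torusIncl m t) = t :=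
  DFunLike.congr_fun (torusProj_comp_torusIncl m) t

theorem TorusGroup.proj_comp_sec (y₀ : Y) (m : ℕ) :
    (TorusGroup.proj y₀ m).comp (TorusGroup.sec y₀ m) = MonoidHom.id _ := by
  refine MonoidHom.ext fun a => ?_
  obtain ⟨γ, rfl⟩ := TorusGroup.mk_surjective a
  rw [MonoidHom.comp_apply, TorusGroup.sec_mk, TorusGroup.proj_mk, MonoidHom.id_apply]
  congr 1
  ext s t
  exact congrArg (γ s) (torusProj_torusIncl t)

end TorusGroup

/-! ### The Rhodes groups -/

section Rhodes

variable {G X : Type*} [Group G] [TopologicalSpace X] [MulAction G X] [ContinuousConstSMul G X]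

theorem RhodesGroup.proj_comp_sec (x₀ : X) (m : ℕ) :
    (RhodesGroup.proj G x₀ m).comp (RhodesGroup.sec G x₀ m) = MonoidHom.id _ := by
  refine MonoidHom.ext fun a => ?_
  induction a using RhodesGroup.ind with | h g f => ?_
  -- The representative itself is unchanged, so no homotopy is needed.
  refine congrArg RhodesGroup.mk (a₁ := (f.pullback (torusProj m)).pullback (torusIncl m)) ?_
  obtain ⟨f, h0, h1⟩ := f
  simp only [OrderMap.pullback, OrderMap.mk.injEq]
  ext ⟨s, t⟩
  exact congrArg (fun t => f (s, t)) (torusProj_torusIncl t)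

variable (G) in
-- Homotopy of paths in `X^(T^k)` with fixed ends is the same relation as homotopy relative to the
-- ends of the cylinder, by `homotopic_pathOf_iff`.
theorem RhodesGroup.ofTorus_injective (x₀ : X) (k : ℕ) :
    Function.Injective (RhodesGroup.ofTorus G x₀ k) := by
  intro a b hab
  obtain ⟨γ, rfl⟩ := TorusGroup.mk_surjective a
  obtain ⟨δ, rfl⟩ := TorusGroup.mk_surjective b
  rw [RhodesGroup.ofTorus_mk, RhodesGroup.ofTorus_mk] at hab
  -- Both classes lie over `1 ∈ G`, so the heterogeneous equality of second components is an
  -- ordinary one.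
  have h := Quotient.exact (eq_of_heq (Sigma.mk.inj hab).2)
  exact TorusGroup.mk_eq_mk.2 ((homotopic_pathOf_iff (fun t => DFunLike.congr_fun γ.source t)
    (fun t => DFunLike.congr_fun γ.target t) (fun t => DFunLike.congr_fun δ.source t)
    (fun t => DFunLike.congr_fun δ.target t)).2 h)

variable (G) in
theorem RhodesGroup.range_ofTorus (x₀ : X) (k : ℕ) :
    (RhodesGroup.ofTorus G x₀ k).range = (RhodesGroup.order G x₀ k).ker := by
  ext a
  constructor
  · rintro ⟨b, rfl⟩
    obtain ⟨γ, rfl⟩ := TorusGroup.mk_surjective b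
    rfl
  · intro ha
    induction a using RhodesGroup.ind with | h g f => ?_
    obtain rfl : g = 1 := ha
    exact ⟨TorusGroup.mk (pathOf f.toMap f.map_zero (fun t => (f.map_one t).trans (one_smul _ _))),
      rfl⟩

variable (G) in
theorem RhodesGroup.proj_comp_ofTorus (x₀ : X) (m : ℕ) :
    (RhodesGroup.proj G x₀ m).comp (RhodesGroup.ofTorus G x₀ (m + 1))
      = (RhodesGroup.ofTorus G x₀ m).comp (TorusGroup.proj x₀ m) := by
  refine MonoidHom.ext fun a => ?_
  obtain ⟨γ, rfl⟩ := TorusGroup.mk_surjective a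
  rw [MonoidHom.comp_apply, MonoidHom.comp_apply, TorusGroup.proj_mk]
  rfl

variable (G) in
theorem RhodesGroup.sec_comp_ofTorus (x₀ : X) (m : ℕ) :
    (RhodesGroup.sec G x₀ m).comp (RhodesGroup.ofTorus G x₀ m)
      = (RhodesGroup.ofTorus G x₀ (m + 1)).comp (TorusGroup.sec x₀ m) := by
  refine MonoidHom.ext fun a => ?_
  obtain ⟨γ, rfl⟩ := TorusGroup.mk_surjective a
  rw [MonoidHom.comp_apply, MonoidHom.comp_apply, TorusGroup.sec_mk]
  rfl

variable (G) in
theorem RhodesGroup.range_ofLoop (x₀ : X) (m : ℕ) :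
    (RhodesGroup.ofLoop G x₀ m).range = (RhodesGroup.proj G x₀ m).ker := by
  have comm (b) : RhodesGroup.proj G x₀ m (RhodesGroup.ofTorus G x₀ (m + 1) b)
      = RhodesGroup.ofTorus G x₀ m (TorusGroup.proj x₀ m b) :=
    DFunLike.congr_fun (RhodesGroup.proj_comp_ofTorus G x₀ m) b
  ext a
  constructor
  · rintro ⟨b, rfl⟩
    rw [MonoidHom.mem_ker, RhodesGroup.ofLoop, MonoidHom.comp_apply, comm, TorusGroup.proj_ofLoop,
      map_one]
  · intro ha
    -- The projection preserves the `G`-component by definition, so `a` lies over `1` and comes from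
    -- Fox's group.
    have ha' : a ∈ (RhodesGroup.order G x₀ (m + 1)).ker :=
      (congrArg (RhodesGroup.order G x₀ m) (MonoidHom.mem_ker.1 ha) :)
    rw [← RhodesGroup.range_ofTorus] at ha'
    obtain ⟨b, rfl⟩ := ha'
    -- Injectivity of `ofTorus` one level down moves the kernel condition to Fox's sequence, whose
    -- exactness applies.
    rw [MonoidHom.mem_ker, comm, map_eq_one_iff _ (RhodesGroup.ofTorus_injective G x₀ m),
      ← MonoidHom.mem_ker, ← TorusGroup.range_ofLoop] at ha
    obtain ⟨c, rfl⟩ := ha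
    exact ⟨c, rfl⟩

end Rhodes

end RhodesTheory

theorem theorem1p3 {G X : Type*} [Group G] [Finite G] [TopologicalSpace X] [T2Space X]
    [CompactlyGeneratedSpace X] [PathConnectedSpace X] [MulAction G X] [ContinuousConstSMul G X]
    (x₀ : X) (m : ℕ) :
    -- the split short exact sequence of Rhodes groups, with `n = m + 2`
    (Function.Injective (RhodesTheory.RhodesGroup.ofLoop G x₀ m) ∧
      (RhodesTheory.RhodesGroup.ofLoop G x₀ m).range
        = (RhodesTheory.RhodesGroup.proj G x₀ m).ker ∧
      Function.Surjective (RhodesTheory.RhodesGroup.proj G x₀ m) ∧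
      (RhodesTheory.RhodesGroup.proj G x₀ m).comp (RhodesTheory.RhodesGroup.sec G x₀ m)
        = MonoidHom.id _) ∧
    -- Fox's split short exact sequence of torus homotopy groups
    (Function.Injective (RhodesTheory.TorusGroup.ofLoop x₀ m) ∧
      (RhodesTheory.TorusGroup.ofLoop x₀ m).range = (RhodesTheory.TorusGroup.proj x₀ m).ker ∧
      Function.Surjective (RhodesTheory.TorusGroup.proj x₀ m) ∧
      (RhodesTheory.TorusGroup.proj x₀ m).comp (RhodesTheory.TorusGroup.sec x₀ m)
        = MonoidHom.id _) ∧
    -- Fox's sequence is embedded in the Rhodes sequence, as the part lying over `1 ∈ G`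
    (∀ k : ℕ, Function.Injective (RhodesTheory.RhodesGroup.ofTorus G x₀ k) ∧
      (RhodesTheory.RhodesGroup.ofTorus G x₀ k).range
        = (RhodesTheory.RhodesGroup.order G x₀ k).ker) ∧
    (RhodesTheory.RhodesGroup.ofTorus G x₀ (m + 1)).comp (RhodesTheory.TorusGroup.ofLoop x₀ m)
      = RhodesTheory.RhodesGroup.ofLoop G x₀ m ∧
    (RhodesTheory.RhodesGroup.proj G x₀ m).comp (RhodesTheory.RhodesGroup.ofTorus G x₀ (m + 1))
      = (RhodesTheory.RhodesGroup.ofTorus G x₀ m).comp (RhodesTheory.TorusGroup.proj x₀ m) ∧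
    (RhodesTheory.RhodesGroup.sec G x₀ m).comp (RhodesTheory.RhodesGroup.ofTorus G x₀ m)
      = (RhodesTheory.RhodesGroup.ofTorus G x₀ (m + 1)).comp (RhodesTheory.TorusGroup.sec x₀ m) := by
  have sR := RhodesTheory.RhodesGroup.proj_comp_sec (G := G) x₀ m
  have sT := RhodesTheory.TorusGroup.proj_comp_sec x₀ m
  exact ⟨⟨(RhodesTheory.RhodesGroup.ofTorus_injective G x₀ (m + 1)).comp
      (RhodesTheory.TorusGroup.ofLoop_injective x₀ m),
    RhodesTheory.RhodesGroup.range_ofLoop G x₀ m,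
    fun a => ⟨_, DFunLike.congr_fun sR a⟩, sR⟩,
   ⟨RhodesTheory.TorusGroup.ofLoop_injective x₀ m, RhodesTheory.TorusGroup.range_ofLoop x₀ m,
    fun a => ⟨_, DFunLike.congr_fun sT a⟩, sT⟩,
   fun k => ⟨RhodesTheory.RhodesGroup.ofTorus_injective G x₀ k,
    RhodesTheory.RhodesGroup.range_ofTorus G x₀ k⟩,
   rfl, RhodesTheory.RhodesGroup.proj_comp_ofTorus G x₀ m,
   RhodesTheory.RhodesGroup.sec_comp_ofTorus G x₀ m⟩
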